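/- Let $\mathcal H$ be a complex Hilbert space with an orthogonal splitting $\mathcal H=H_1\oplus H_2$ into closed subspaces, let $P_1$ be the orthogonal projection onto $H_1$, and let $\Omega$ be a (possibly unbounded) self-adjoint operator in $\mathcal H$ of the block form $$\Omega=\begin{bmatrix}\Omega_1&\Gamma\\ \Gamma^\dagger&\Omega_2\end{bmatrix},\qquad \mathrm{Dom}\,\Omega=\mathrm{Dom}\,\Omega_1\oplus\mathrm{Dom}\,\Omega_2,$$ where $\Omega_i$ is a linear operator in $H_i$ with domain $\mathrm{Dom}\,\Omega_i$ ($i=1,2$) and $\Gamma:H_2\to H_1$ is bounded. Put $H_{1\Gamma}=\overline{\mathrm{Ran}\,\Gamma}\subseteq H_1$ and $H_{2\Gamma}=\overline{\mathrm{Ran}\,\Gamma^\dagger}\subseteq H_2$, and let $U:H_{1\Gamma}\to H_{2\Gamma}$ be the unitary factor of the polar decomposition $\Gamma^\dagger=U(\Gamma\Gamma^\dagger)^{1/2}$. Let $H_0$ be a Hilbert space with unitary operators $U_1:H_0\to H_{1\Gamma}$ and $U_2:H_0\to H_{2\Gamma}$ such that $U_2U_1^{-1}=U$, and let $\Gamma_0=U_1^{-1}\Gamma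 U_2=U_2^{-1}\Gamma^\dagger U_1$ be the operator on $H_0$ that represents $\Gamma$. For a set $X$ with a $\sigma$-algebra $\mathcal B$ of subsets, a resolution of the identity on a Hilbert space $K$ is a map $\pi:\mathcal B\to\mathcal L(K)$ such that, for all $A,B\in\mathcal B$: $\pi(A)$ is an orthogonal projection; $\pi(\emptyset)=0$ and $\pi(X)=\mathbb I_K$; $\pi(X\setminus A)=\mathbb I_K-\pi(A)$; $\pi(A\cap B)=\pi(A)\pi(B)$; $\pi(A\cup B)=\pi(A)+\pi(B)$ if $A\cap B=\emptyset$; and $\pi(\bigcap_{n}A_n)=\mathrm{s\text{-}lim}_{n\to\infty}\,\pi(A_n)$ for every decreasing sequence $(A_n)$ in $\mathcal B$. It commutes with an operator $T$ in $K$ if, for every $A\in\mathcal B$, $\pi(A)$ maps $\mathrm{Dom}\,T$ into itself and $\pi(A)Tv=T\pi(A)v$ for all $v\in\mathrm{Dom}\,T$. Theorem. Let $\pi:\mathcal B\to\mathcal L(\mathcal H)$ be a resolution of the identity on $\mathcal H$ that commutes with $\Omega$ and $P_1$. Then there exists a resolution of the identity $E_\pi:\mathcal B\to\mathcal L(H_0)$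 on $H_0$ that commutes with $\Gamma_0$ and satisfies, for all $A\in\mathcal B$, $$U_iE_\pi(A)=\pi(A)U_i,\qquad \mathrm{Ran}\,(U_iE_\pi(A))=\mathrm{Ran}\,\pi(A)\cap H_{i\Gamma},\qquad i=1,2.$$ -/

import Mathlib

open Filter Topology
open scoped InnerProduct

noncomputable section

namespace CoupledSystem

/-! ### Resolutions of the identity -/

section Resolution

/-- A resolution of the identity of the Hilbert space `H` over the measurable space `X`: a
projection-valued set function on the `σ`-algebra of `X`.  Only the values `π A` at measurable sets
`A` are meaningful. -/
structure IsResolutionOfIdentity {X : Type*} [MeasurableSpace X] {H : Type*}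
    [NormedAddCommGroup H] [InnerProductSpace ℂ H] [CompleteSpace H]
    (π : Set X → H →L[ℂ] H) : Prop where
  /-- Every value is an orthogonal projection (idempotent and self-adjoint). -/
  isStarProjection : ∀ A, MeasurableSet A → IsStarProjection (π A)
  empty : π ∅ = 0
  univ : π Set.univ = 1
  compl : ∀ A, MeasurableSet A → π Aᶜ = 1 - π A
  inter : ∀ A B, MeasurableSet A → MeasurableSet B → π (A ∩ B) = π A * π B
  union : ∀ A B, MeasurableSet A → MeasurableSet B → A ∩ B = ∅ → π (A ∪ B) = π A + π B
  /-- Continuity from above in the strong operator topology. -/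
  iInter : ∀ A : ℕ → Set X, (∀ n, MeasurableSet (A n)) → (∀ n, A (n + 1) ⊆ A n) →
    ∀ v : H, Tendsto (fun n => π (A n) v) atTop (𝓝 (π (⋂ n, A n) v))

/-- `π` commutes with the bounded operator `T`. -/
def CommutesWith {X : Type*} [MeasurableSpace X] {H : Type*}
    [NormedAddCommGroup H] [InnerProductSpace ℂ H]
    (π : Set X → H →L[ℂ] H) (T : H →L[ℂ] H) : Prop :=
  ∀ A, MeasurableSet A → π A ∘L T = T ∘L π A

/-- `π` commutes with the (possibly unbounded) operator `T`, i.e. `π A T ⊆ T π A`: each `π A`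
maps the domain of `T` into itself, and `π A T v = T π A v` on that domain. -/
def CommutesWithUnbounded {X : Type*} [MeasurableSpace X] {H : Type*}
    [NormedAddCommGroup H] [InnerProductSpace ℂ H]
    (π : Set X → H →L[ℂ] H) (T : H →ₗ.[ℂ] H) : Prop :=
  ∀ A, MeasurableSet A → ∀ v : T.domain,
    ∃ h : π A (v : H) ∈ T.domain, π A (T v) = T ⟨π A (v : H), h⟩

end Resolution

/-! ### The polar isometry of a bounded operator `Γ : H₂ → H₁` -/

section Polar

variable {H₁ H₂ : Type*}
  [NormedAddCommGroup H₁] [InnerProductSpace ℂ H₁] [CompleteSpace H₁]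
  [NormedAddCommGroup H₂] [InnerProductSpace ℂ H₂] [CompleteSpace H₂]

/-- The closure of the range of a bounded operator. -/
abbrev clRan (Γ : H₂ →L[ℂ] H₁) : Submodule ℂ H₁ := Γ.range.topologicalClosure

/-- The positive part `(Γ Γ†)^{1/2}` of `Γ†`. -/
def absAdjoint (Γ : H₂ →L[ℂ] H₁) : H₁ →L[ℂ] H₁ := CFC.sqrt (Γ ∘L Γ.adjoint)

set_option linter.unusedSectionVars false in
theorem mem_clRan (Γ : H₂ →L[ℂ] H₁) (y : H₂) : Γ y ∈ clRan Γ :=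
  Γ.range.le_topologicalClosure ⟨y, rfl⟩

theorem isSelfAdjoint_absAdjoint (Γ : H₂ →L[ℂ] H₁) : (absAdjoint Γ).adjoint = absAdjoint Γ :=
  (IsSelfAdjoint.of_nonneg (CFC.sqrt_nonneg (Γ ∘L Γ.adjoint))).adjoint_eq

theorem absAdjoint_mul_self (Γ : H₂ →L[ℂ] H₁) :
    absAdjoint Γ ∘L absAdjoint Γ = Γ ∘L Γ.adjoint :=
  CFC.sqrt_mul_sqrt_self (Γ ∘L Γ.adjoint)
    ((ContinuousLinearMap.nonneg_iff_isPositive _).2 Γ.isPositive_self_comp_adjoint)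

theorem norm_absAdjoint (Γ : H₂ →L[ℂ] H₁) (x : H₁) : ‖absAdjoint Γ x‖ = ‖Γ.adjoint x‖ := by
  have h : inner ℂ (absAdjoint Γ x) (absAdjoint Γ x)
      = inner ℂ (Γ.adjoint x) (Γ.adjoint x) := by
    rw [← ContinuousLinearMap.adjoint_inner_right, isSelfAdjoint_absAdjoint,
      ContinuousLinearMap.adjoint_inner_left, ← ContinuousLinearMap.comp_apply,
      absAdjoint_mul_self, ContinuousLinearMap.comp_apply]
  rw [inner_self_eq_norm_sq_to_K, inner_self_eq_norm_sq_to_K] at h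
  have h' : ‖absAdjoint Γ x‖ ^ 2 = ‖Γ.adjoint x‖ ^ 2 := by exact_mod_cast h
  exact (pow_left_inj₀ (norm_nonneg _) (norm_nonneg _) two_ne_zero).1 h'

theorem clRan_absAdjoint (Γ : H₂ →L[ℂ] H₁) : clRan (absAdjoint Γ) = clRan Γ := by
  have hk : (absAdjoint Γ).ker = Γ.adjoint.ker := by
    ext x
    simp only [LinearMap.mem_ker, ContinuousLinearMap.coe_coe]
    rw [← norm_eq_zero, norm_absAdjoint, norm_eq_zero]
  rw [clRan, clRan, ← Submodule.orthogonal_orthogonal_eq_closure,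
    ← Submodule.orthogonal_orthogonal_eq_closure, ContinuousLinearMap.orthogonal_range,
    ContinuousLinearMap.orthogonal_range, isSelfAdjoint_absAdjoint, hk]

theorem absAdjoint_mem (Γ : H₂ →L[ℂ] H₁) (x : H₁) : absAdjoint Γ x ∈ clRan Γ :=
  clRan_absAdjoint Γ ▸ mem_clRan (absAdjoint Γ) x

theorem denseRange_codRestrict {E F : Type*} [NormedAddCommGroup E] [InnerProductSpace ℂ E]
    [NormedAddCommGroup F] [InnerProductSpace ℂ F] (T : E →L[ℂ] F) (K : Submodule ℂ F)
    (hK : T.range.topologicalClosure = K) (hT : ∀ x, T x ∈ K) :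
    DenseRange (T.codRestrict K hT) := by
  rintro ⟨y, hy⟩
  rw [closure_subtype]
  have : (fun z : K => (z : F)) '' Set.range (T.codRestrict K hT) = (T.range : Set F) := by
    ext z
    constructor
    · rintro ⟨_, ⟨x, rfl⟩, rfl⟩
      exact ⟨x, rfl⟩
    · rintro ⟨x, rfl⟩
      exact ⟨_, ⟨x, rfl⟩, rfl⟩
  change y ∈ closure ((fun z : K => (z : F)) '' Set.range (T.codRestrict K hT))
  rw [this]
  subst hK
  exact hy

/-- Polar decomposition `Γ† = U (Γ Γ†)^{1/2}`, with `U` a unitary from the closure of `Ran Γ`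
onto the closure of `Ran Γ†`. -/
theorem existsUnique_polarIsometry (Γ : H₂ →L[ℂ] H₁) :
    ∃! U : clRan Γ ≃ₗᵢ[ℂ] clRan Γ.adjoint,
      ∀ x : H₁, (U ⟨absAdjoint Γ x, absAdjoint_mem Γ x⟩ : H₂) = Γ.adjoint x := by
  let e : H₁ →L[ℂ] clRan Γ := (absAdjoint Γ).codRestrict (clRan Γ) (absAdjoint_mem Γ)
  let f : H₁ →L[ℂ] clRan Γ.adjoint :=
    Γ.adjoint.codRestrict (clRan Γ.adjoint) (mem_clRan Γ.adjoint)
  have he : DenseRange e := denseRange_codRestrict _ _ (clRan_absAdjoint Γ) _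
  have hf : DenseRange f := denseRange_codRestrict _ _ rfl _
  have hn : ∀ x, ‖f x‖ = ‖e x‖ := fun x => (norm_absAdjoint Γ x).symm
  let u : clRan Γ →L[ℂ] clRan Γ.adjoint := LinearMap.extendOfNorm (f : H₁ →ₗ[ℂ] _) (e : H₁ →ₗ[ℂ] _)
  have hu : ∀ x, u (e x) = f x := fun x =>
    LinearMap.extendOfNorm_eq he ⟨1, fun x => by simpa using (hn x).le⟩ x
  have hnorm : ∀ y, ‖u y‖ = ‖y‖ := by
    intro y
    refine he.induction_on y (isClosed_eq (by fun_prop) (by fun_prop)) ?_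
    intro x
    rw [hu, hn]
  let ui : clRan Γ →ₗᵢ[ℂ] clRan Γ.adjoint := ⟨u, hnorm⟩
  have hsurj : Function.Surjective ui := by
    have hcl : IsClosed (Set.range ui) := ui.isometry.isClosedEmbedding.isClosed_range
    have hd : DenseRange ui := hf.mono (by
      rintro _ ⟨x, rfl⟩
      exact ⟨e x, hu x⟩)
    rw [← Set.range_eq_univ, ← hcl.closure_eq]
    exact hd.closure_range
  refine ⟨LinearIsometryEquiv.ofSurjective ui hsurj, fun x => ?_, ?_⟩
  · exact congrArg Subtype.val (hu x)
  · intro V hV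
    have : (V : clRan Γ → clRan Γ.adjoint) = ui := by
      refine he.equalizer V.continuous ui.continuous ?_
      funext x
      apply Subtype.ext
      exact (hV x).trans (congrArg Subtype.val (hu x)).symm
    ext y
    exact congrArg Subtype.val (congrFun this y)

/-- The canonical unitary `U = Γ† (Γ Γ†)^{-1/2}` from the closure of `Ran Γ` onto the closure of
`Ran Γ†`, that is, the unitary factor of the polar decomposition `Γ† = U (Γ Γ†)^{1/2}`. -/
def polarIsometry (Γ : H₂ →L[ℂ] H₁) : clRan Γ ≃ₗᵢ[ℂ] clRan Γ.adjoint :=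
  (existsUnique_polarIsometry Γ).choose

theorem polarIsometry_absAdjoint (Γ : H₂ →L[ℂ] H₁) (x : H₁) :
    (polarIsometry Γ ⟨absAdjoint Γ x, absAdjoint_mem Γ x⟩ : H₂) = Γ.adjoint x :=
  (existsUnique_polarIsometry Γ).choose_spec.1 x

/-- `Γ_R`: the operator `Γ` restricted to (the closures of) `Ran Γ†` and `Ran Γ`, both in domain
and in target. -/
def restrictRan (Γ : H₂ →L[ℂ] H₁) : clRan Γ.adjoint →L[ℂ] clRan Γ :=
  (Γ ∘L (clRan Γ.adjoint).subtypeL).codRestrict (clRan Γ) fun y => mem_clRan Γ y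

/-- A model of the coupling operator `Γ` on a Hilbert space `H₀`: unitaries `U₁` of `H₀` onto the
closure of `Ran Γ` and `U₂` of `H₀` onto the closure of `Ran Γ†`, with `U₂ U₁⁻¹ = U`. -/
structure Model (Γ : H₂ →L[ℂ] H₁) (H₀ : Type*) [NormedAddCommGroup H₀]
    [InnerProductSpace ℂ H₀] where
  U₁ : H₀ ≃ₗᵢ[ℂ] clRan Γ
  U₂ : H₀ ≃ₗᵢ[ℂ] clRan Γ.adjoint
  symm_trans : U₁.symm.trans U₂ = polarIsometry Γ

/-- The model operator `Γ₀ = U₁⁻¹ Γ U₂` on `H₀`. -/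
def Model.Γ₀ {Γ : H₂ →L[ℂ] H₁} {H₀ : Type*} [NormedAddCommGroup H₀] [InnerProductSpace ℂ H₀]
    (M : Model Γ H₀) : H₀ →L[ℂ] H₀ :=
  (M.U₁.symm : clRan Γ →L[ℂ] H₀) ∘L restrictRan Γ ∘L (M.U₂ : H₀ →L[ℂ] clRan Γ.adjoint)

/-- `Γ U = (Γ Γ†)^{1/2}` on the closure of `Ran Γ`. -/
theorem apply_polarIsometry (Γ : H₂ →L[ℂ] H₁) (y : clRan Γ) :
    Γ (polarIsometry Γ y) = absAdjoint Γ y := by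
  have hd := denseRange_codRestrict (absAdjoint Γ) (clRan Γ) (clRan_absAdjoint Γ)
    (absAdjoint_mem Γ)
  refine hd.induction_on y (isClosed_eq (by fun_prop) (by fun_prop)) fun x => ?_
  change Γ (polarIsometry Γ ⟨absAdjoint Γ x, absAdjoint_mem Γ x⟩) = absAdjoint Γ (absAdjoint Γ x)
  rw [polarIsometry_absAdjoint]
  exact (DFunLike.congr_fun (absAdjoint_mul_self Γ) x).symm

/-- The other expression for the model operator: `Γ₀ = U₂⁻¹ Γ† U₁`. -/
theorem Model.U₂_Γ₀ {Γ : H₂ →L[ℂ] H₁} {H₀ : Type*} [NormedAddCommGroup H₀]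
    [InnerProductSpace ℂ H₀] (M : Model Γ H₀) (u : H₀) :
    (M.U₂ (M.Γ₀ u) : H₂) = Γ.adjoint (M.U₁ u) := by
  have h : ∀ w, M.U₂ w = polarIsometry Γ (M.U₁ w) := fun w => by
    rw [← M.symm_trans]
    simp
  have hΓ : M.U₁ (M.Γ₀ u) = ⟨absAdjoint Γ (M.U₁ u), absAdjoint_mem Γ _⟩ := by
    apply Subtype.ext
    have : M.U₁ (M.Γ₀ u) = restrictRan Γ (M.U₂ u) := M.U₁.apply_symm_apply _
    rw [this, h u]
    exact apply_polarIsometry Γ _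
  rw [h, hΓ, polarIsometry_absAdjoint]

/-- The canonical model, with `H₀` the closure of `Ran Γ`, `U₁ = I` and `U₂ = U`. -/
def Model.canonical (Γ : H₂ →L[ℂ] H₁) : Model Γ (clRan Γ) where
  U₁ := LinearIsometryEquiv.refl ℂ _
  U₂ := polarIsometry Γ
  symm_trans := rfl

end Polar

/-! ### Coupled systems -/

section System

variable {H : Type*} [NormedAddCommGroup H] [InnerProductSpace ℂ H] [CompleteSpace H]

/-- The frequency operator of a coupled system, given in block form with respect to
`H = H₁ ⊕ H₁ᗮ` by
`Ω = [Ω₁, Γ; Γ†, Ω₂]`, with domain `Dom Ω₁ ⊕ Dom Ω₂`. -/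
def blockOperator (H₁ : Submodule ℂ H) [CompleteSpace H₁]
    (Ω₁ : H₁ →ₗ.[ℂ] H₁) (Ω₂ : H₁ᗮ →ₗ.[ℂ] H₁ᗮ) (Γ : H₁ᗮ →L[ℂ] H₁) : H →ₗ.[ℂ] H where
  domain :=
    Ω₁.domain.comap (H₁.orthogonalProjectionOnto : H →ₗ[ℂ] H₁) ⊓
      Ω₂.domain.comap (H₁ᗮ.orthogonalProjectionOnto : H →ₗ[ℂ] H₁ᗮ)
  toFun :=
    { toFun := fun v =>
        ((Ω₁ ⟨H₁.orthogonalProjectionOnto v, v.2.1⟩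
          + Γ (H₁ᗮ.orthogonalProjectionOnto (v : H)) : H₁) : H)
        + ((Γ.adjoint (H₁.orthogonalProjectionOnto (v : H))
          + Ω₂ ⟨H₁ᗮ.orthogonalProjectionOnto v, v.2.2⟩ : H₁ᗮ) : H)
      map_add' := by
        intro v w
        have h₁ : Ω₁ ⟨H₁.orthogonalProjectionOnto ((v + w : _) : H), (v + w).2.1⟩
            = Ω₁ ⟨H₁.orthogonalProjectionOnto v, v.2.1⟩
              + Ω₁ ⟨H₁.orthogonalProjectionOnto w, w.2.1⟩ := by
          rw [← LinearPMap.map_add]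
          congr 1
          exact Subtype.ext (by simp)
        have h₂ : Ω₂ ⟨H₁ᗮ.orthogonalProjectionOnto ((v + w : _) : H), (v + w).2.2⟩
            = Ω₂ ⟨H₁ᗮ.orthogonalProjectionOnto v, v.2.2⟩
              + Ω₂ ⟨H₁ᗮ.orthogonalProjectionOnto w, w.2.2⟩ := by
          rw [← LinearPMap.map_add]
          congr 1
          exact Subtype.ext (by simp)
        rw [h₁, h₂]
        simp only [Submodule.coe_add, map_add]
        abel
      map_smul' := by
        intro c v
        have h₁ : Ω₁ ⟨H₁.orthogonalProjectionOnto ((c • v : _) : H), (c • v).2.1⟩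
            = c • Ω₁ ⟨H₁.orthogonalProjectionOnto v, v.2.1⟩ := by
          rw [← LinearPMap.map_smul]
          congr 1
          exact Subtype.ext (by simp)
        have h₂ : Ω₂ ⟨H₁ᗮ.orthogonalProjectionOnto ((c • v : _) : H), (c • v).2.2⟩
            = c • Ω₂ ⟨H₁ᗮ.orthogonalProjectionOnto v, v.2.2⟩ := by
          rw [← LinearPMap.map_smul]
          congr 1
          exact Subtype.ext (by simp)
        rw [h₁, h₂]
        simp only [Submodule.coe_smul, map_smul, smul_add, Submodule.coe_add, RingHom.id_apply] }

variable {H₁ : Submodule ℂ H} [CompleteSpace H₁] {Γ : H₁ᗮ →L[ℂ] H₁}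
  {H₀ : Type*} [NormedAddCommGroup H₀] [InnerProductSpace ℂ H₀]

/-- `H_{1Γ}`, the closure of `Ran Γ`, as a subspace of `H`. -/
def H₁Γ (Γ : H₁ᗮ →L[ℂ] H₁) : Submodule ℂ H := (clRan Γ).map H₁.subtype

/-- `H_{2Γ}`, the closure of `Ran Γ†`, as a subspace of `H`. -/
def H₂Γ (Γ : H₁ᗮ →L[ℂ] H₁) : Submodule ℂ H := (clRan Γ.adjoint).map H₁ᗮ.subtype

/-- `U₁` as an operator from `H₀` into `H`. -/
def Model.V₁ (M : Model Γ H₀) : H₀ →L[ℂ] H :=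
  H₁.subtypeL ∘L (clRan Γ).subtypeL ∘L (M.U₁ : H₀ →L[ℂ] clRan Γ)

/-- `U₂` as an operator from `H₀` into `H`. -/
def Model.V₂ (M : Model Γ H₀) : H₀ →L[ℂ] H :=
  H₁ᗮ.subtypeL ∘L (clRan Γ.adjoint).subtypeL ∘L (M.U₂ : H₀ →L[ℂ] clRan Γ.adjoint)

end System

end CoupledSystem

end

open Filter Topology
open scoped InnerProduct

noncomputable section

namespace CoupledSystem

/-! ### Compressions of operators that respect an orthogonal splitting. -/

section Compression

variable {H : Type*} [NormedAddCommGroup H] [InnerProductSpace ℂ H]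

/-! Fix `A` and write `T = π A`. Commuting with the projection onto `H₁` makes `T` block diagonal,
`T = T₁ ⊕ T₂`. Commuting with `Ω`, tested on vectors `0 ⊕ v` with `v ∈ Dom Ω₂` and projected to
`H₁`, isolates the corner: `T₁ Γ v = Γ T₂ v`. Self-adjointness of `Ω` makes its domain, hence `Dom
Ω₂`, dense, so `T₁ Γ = Γ T₂` everywhere (`compression_comp_coupling`); as `T` is self-adjoint,
taking adjoints gives `T₂ Γ† = Γ† T₁`.

So `T₁` commutes with `Γ Γ†`, hence with its square root, and the polar factor satisfies `U T₁ = T₂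
U` (`polarIsometry_comm`). Put `E A = V₁† T V₁`. Since `T` preserves the range of `V₁`, this is `T`
transported through `U₁`; by `U T₁ = T₂ U` it is also `T` transported through `U₂`. The axioms for
`E` pull back along the isometry `V₁` (`IsResolutionOfIdentity.pullback`), and the range formulas
follow from `V E = T V` with `T` idempotent. -/

/-- The compression of a bounded operator to a complete subspace. -/
def compression (K : Submodule ℂ H) [K.HasOrthogonalProjection] (T : H →L[ℂ] H) : K →L[ℂ] K :=
  K.orthogonalProjectionOnto ∘L T ∘L K.subtypeL

theorem coe_compression {K : Submodule ℂ H} [K.HasOrthogonalProjection] {T : H →L[ℂ] H}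
    (hT : ∀ x ∈ K, T x ∈ K) (x : K) : (compression K T x : H) = T x :=
  K.starProjection_eq_self_iff.2 (hT x x.2)

theorem isSelfAdjoint_compression [CompleteSpace H] (K : Submodule ℂ H) [CompleteSpace K]
    {T : H →L[ℂ] H} (hT : IsSelfAdjoint T) : (compression K T).adjoint = compression K T := by
  simp only [compression, ContinuousLinearMap.adjoint_comp, Submodule.adjoint_subtypeL,
    Submodule.adjoint_orthogonalProjectionOnto, hT.adjoint_eq]
  rfl

theorem apply_mem_of_commute {K : Submodule ℂ H} [K.HasOrthogonalProjection] {T : H →L[ℂ] H}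
    (hT : T ∘L K.starProjection = K.starProjection ∘L T) {x : H} (hx : x ∈ K) : T x ∈ K := by
  have h := DFunLike.congr_fun hT x
  simp only [ContinuousLinearMap.comp_apply, K.starProjection_eq_self_iff.2 hx] at h
  exact K.starProjection_eq_self_iff.1 h.symm

theorem apply_mem_orthogonal_of_commute {K : Submodule ℂ H} [K.HasOrthogonalProjection]
    {T : H →L[ℂ] H} (hT : T ∘L K.starProjection = K.starProjection ∘L T) {x : H} (hx : x ∈ Kᗮ) :
    T x ∈ Kᗮ := by
  have h := DFunLike.congr_fun hT x
  simp only [ContinuousLinearMap.comp_apply, K.starProjection_apply_eq_zero_iff.2 hx,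
    map_zero] at h
  exact K.starProjection_apply_eq_zero_iff.1 h.symm

end Compression

/-! ### Intertwining relations pass to the polar factor. -/

section Intertwining

variable {H₁ H₂ : Type*}
  [NormedAddCommGroup H₁] [InnerProductSpace ℂ H₁]
  [NormedAddCommGroup H₂] [InnerProductSpace ℂ H₂]
  {Γ : H₂ →L[ℂ] H₁} {Q₁ : H₁ →L[ℂ] H₁} {Q₂ : H₂ →L[ℂ] H₂}

theorem apply_mem_clRan (h : Q₁ ∘L Γ = Γ ∘L Q₂) {x : H₁} (hx : x ∈ clRan Γ) :
    Q₁ x ∈ clRan Γ := by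
  refine map_mem_closure Q₁.continuous hx ?_
  rintro _ ⟨y, rfl⟩
  exact ⟨Q₂ y, (DFunLike.congr_fun h y).symm⟩

variable [CompleteSpace H₁] [CompleteSpace H₂]

/-- The two relations give `Γ Γ† Q₁ = Γ Q₂ Γ† = Q₁ Γ Γ†`, and the functional calculus carries this
commutation over to the square root. -/
theorem absAdjoint_comm (h : Q₁ ∘L Γ = Γ ∘L Q₂) (h' : Q₂ ∘L Γ.adjoint = Γ.adjoint ∘L Q₁)
    (x : H₁) : absAdjoint Γ (Q₁ x) = Q₁ (absAdjoint Γ x) := by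
  have hc : Commute (Γ ∘L Γ.adjoint) Q₁ := by
    change (Γ ∘L Γ.adjoint) ∘L Q₁ = Q₁ ∘L (Γ ∘L Γ.adjoint)
    rw [ContinuousLinearMap.comp_assoc, ← h', ← ContinuousLinearMap.comp_assoc, ← h,
      ContinuousLinearMap.comp_assoc]
  exact DFunLike.congr_fun (hc.cfcₙ_nnreal NNReal.sqrt).eq x

theorem polarIsometry_comm (h : Q₁ ∘L Γ = Γ ∘L Q₂) (h' : Q₂ ∘L Γ.adjoint = Γ.adjoint ∘L Q₁)
    (y : clRan Γ) :
    (polarIsometry Γ ⟨Q₁ y, apply_mem_clRan h y.2⟩ : H₂) = Q₂ (polarIsometry Γ y) := by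
  have hd := denseRange_codRestrict (absAdjoint Γ) (clRan Γ) (clRan_absAdjoint Γ)
    (absAdjoint_mem Γ)
  -- By density take `y = |Γ†| x`; then `U Q₁ |Γ†| x = U |Γ†| Q₁ x = Γ† Q₁ x = Q₂ Γ† x`.
  refine hd.induction_on y (isClosed_eq (by fun_prop) (by fun_prop)) fun x => ?_
  change (polarIsometry Γ ⟨Q₁ (absAdjoint Γ x), _⟩ : H₂)
    = Q₂ (polarIsometry Γ ⟨absAdjoint Γ x, absAdjoint_mem Γ x⟩)
  simp only [← absAdjoint_comm h h', polarIsometry_absAdjoint]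
  exact (DFunLike.congr_fun h' x).symm

end Intertwining

/-! ### Pulling projections back along an isometry. -/

section Transport

variable {H : Type*} [NormedAddCommGroup H] [InnerProductSpace ℂ H]
  {H₀ : Type*} [NormedAddCommGroup H₀] [InnerProductSpace ℂ H₀]

theorem range_comp_eq_inf {V : H₀ →L[ℂ] H} {T : H →L[ℂ] H} {E : H₀ →L[ℂ] H₀}
    (hT : IsIdempotentElem T) (h : V ∘L E = T ∘L V) : (V ∘L E).range = T.range ⊓ V.range := by
  apply le_antisymm
  · rintro _ ⟨u, rfl⟩
    exact ⟨⟨V u, (DFunLike.congr_fun h u).symm⟩, ⟨E u, rfl⟩⟩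
  · rintro x ⟨⟨y, rfl⟩, ⟨u, hu⟩⟩
    -- If `x = T y = V u`, then `V E u = T V u = T T y = T y`, so `u` itself is a preimage of `x`.
    refine ⟨u, (DFunLike.congr_fun h u).trans ?_⟩
    change T (V u) = T y
    rw [show V u = T y from hu]
    exact DFunLike.congr_fun hT.eq y

variable [CompleteSpace H] [CompleteSpace H₀]

/-- A resolution of the identity that leaves the range of an isometry invariant pulls back along
that isometry. -/
theorem IsResolutionOfIdentity.pullback {X : Type*} [MeasurableSpace X] {π : Set X → H →L[ℂ] H}
    (hπ : IsResolutionOfIdentity π) (V : H₀ →ₗᵢ[ℂ] H) {E : Set X → H₀ →L[ℂ] H₀}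
    (hE : ∀ A, MeasurableSet A → ∀ u, V (E A u) = π A (V u)) :
    IsResolutionOfIdentity E where
  isStarProjection A hA := by
    refine ⟨?_, ?_⟩
    · ext u
      -- Each algebraic axiom is tested after applying `V`, where `E A` becomes `π A`.
      apply V.injective
      change V (E A (E A u)) = V (E A u)
      rw [hE A hA, hE A hA]
      exact DFunLike.congr_fun (hπ.isStarProjection A hA).isIdempotentElem.eq (V u)
    · rw [ContinuousLinearMap.isSelfAdjoint_iff_isSymmetric]
      intro u w
      change inner ℂ (E A u) w = inner ℂ u (E A w)
      rw [← V.inner_map_map, ← V.inner_map_map u, hE A hA, hE A hA]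
      exact ContinuousLinearMap.isSelfAdjoint_iff_isSymmetric.1
        (hπ.isStarProjection A hA).isSelfAdjoint (V u) (V w)
  empty := by
    ext u
    apply V.injective
    simp [hE ∅ .empty, hπ.empty]
  univ := by
    ext u
    apply V.injective
    simp [hE _ .univ, hπ.univ]
  compl A hA := by
    ext u
    apply V.injective
    simp [hE _ hA.compl, hE A hA, hπ.compl A hA]
  inter A B hA hB := by
    ext u
    apply V.injective
    simp [hE _ (hA.inter hB), hE A hA, hE B hB, hπ.inter A B hA hB]
  union A B hA hB h := by
    ext u
    apply V.injective
    simp [hE _ (hA.union hB), hE A hA, hE B hB, hπ.union A B hA hB h]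
  iInter A hA hmono v := by
    -- An isometry reflects convergence, so the strong limit can be taken in `H`.
    rw [V.isometry.isEmbedding.tendsto_nhds_iff]
    simp only [Function.comp_def, hE _ (hA _), hE _ (MeasurableSet.iInter hA)]
    exact hπ.iInter A hA hmono (V v)

end Transport

/-! ### The coupling operator and the model space. -/

section System

variable {H : Type*} [NormedAddCommGroup H] [InnerProductSpace ℂ H]
  {H₁ : Submodule ℂ H} {H₀ : Type*} [NormedAddCommGroup H₀] [InnerProductSpace ℂ H₀]

section Block

variable [CompleteSpace H] [CompleteSpace H₁]

/-- On a vector with zero upper component `Ω₁` contributes nothing, which leaves the bounded corner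
alone. -/
theorem projection_blockOperator (Ω₁ : H₁ →ₗ.[ℂ] H₁) (Ω₂ : H₁ᗮ →ₗ.[ℂ] H₁ᗮ)
    (Γ : H₁ᗮ →L[ℂ] H₁) (v : (blockOperator H₁ Ω₁ Ω₂ Γ).domain) (hv : (v : H) ∈ H₁ᗮ) :
    H₁.starProjection (blockOperator H₁ Ω₁ Ω₂ Γ v) = Γ ⟨v, hv⟩ := by
  have h₂ : H₁ᗮ.orthogonalProjectionOnto (v : H) = ⟨v, hv⟩ :=
    Subtype.ext (H₁ᗮ.starProjection_eq_self_iff.2 hv)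
  have h₁ : Ω₁ ⟨H₁.orthogonalProjectionOnto v, v.2.1⟩ = 0 := by
    rw [← Ω₁.map_zero]
    congr 1
    exact Subtype.ext (H₁.orthogonalProjectionOnto_apply_of_mem_orthogonal hv)
  have h : (blockOperator H₁ Ω₁ Ω₂ Γ) v
      = ((Ω₁ ⟨H₁.orthogonalProjectionOnto v, v.2.1⟩
          + Γ (H₁ᗮ.orthogonalProjectionOnto (v : H)) : H₁) : H)
        + ((Γ.adjoint (H₁.orthogonalProjectionOnto (v : H))
          + Ω₂ ⟨H₁ᗮ.orthogonalProjectionOnto v, v.2.2⟩ : H₁ᗮ) : H) := rfl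
  rw [h, map_add, h₁, zero_add, H₁.starProjection_apply_eq_zero_iff.2 (Subtype.property _),
    add_zero, h₂]
  exact H₁.starProjection_eq_self_iff.2 (Subtype.property _)

/-- A continuous surjection maps dense sets to dense sets, and the projection onto `H₁ᗮ` sends the
block domain into `Dom Ω₂`. -/
theorem dense_domain_lower {Ω₁ : H₁ →ₗ.[ℂ] H₁} {Ω₂ : H₁ᗮ →ₗ.[ℂ] H₁ᗮ} {Γ : H₁ᗮ →L[ℂ] H₁}
    (h : Dense ((blockOperator H₁ Ω₁ Ω₂ Γ).domain : Set H)) :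
    Dense (Ω₂.domain : Set H₁ᗮ) := by
  have hs : Function.Surjective H₁ᗮ.orthogonalProjectionOnto := fun y =>
    ⟨y, H₁ᗮ.orthogonalProjectionOnto_mem_subspace_eq_self y⟩
  refine (hs.denseRange.dense_image H₁ᗮ.orthogonalProjectionOnto.continuous h).mono ?_
  rintro _ ⟨v, hv, rfl⟩
  exact hv.2

/-- A bounded operator commuting with the block operator and with the projection onto `H₁`
intertwines the coupling operator. -/
theorem compression_comp_coupling {Ω₁ : H₁ →ₗ.[ℂ] H₁} {Ω₂ : H₁ᗮ →ₗ.[ℂ] H₁ᗮ}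
    {Γ : H₁ᗮ →L[ℂ] H₁} (hd : Dense ((blockOperator H₁ Ω₁ Ω₂ Γ).domain : Set H)) {T : H →L[ℂ] H}
    (hT : T ∘L H₁.starProjection = H₁.starProjection ∘L T)
    (hTΩ : ∀ v : (blockOperator H₁ Ω₁ Ω₂ Γ).domain,
      ∃ h : T (v : H) ∈ (blockOperator H₁ Ω₁ Ω₂ Γ).domain,
        T (blockOperator H₁ Ω₁ Ω₂ Γ v) = blockOperator H₁ Ω₁ Ω₂ Γ ⟨T (v : H), h⟩) :
    compression H₁ T ∘L Γ = Γ ∘L compression H₁ᗮ T := by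
  refine ContinuousLinearMap.ext fun y => ?_
  refine congrFun (Continuous.ext_on (dense_domain_lower hd)
    (ContinuousLinearMap.continuous _) (ContinuousLinearMap.continuous _) fun v hv => ?_) y
  have hm : (v : H) ∈ (blockOperator H₁ Ω₁ Ω₂ Γ).domain := by
    refine ⟨?_, ?_⟩
    · change H₁.orthogonalProjectionOnto (v : H) ∈ Ω₁.domain
      rw [H₁.orthogonalProjectionOnto_apply_of_mem_orthogonal v.2]
      exact Ω₁.domain.zero_mem
    · change H₁ᗮ.orthogonalProjectionOnto (v : H) ∈ Ω₂.domain
      rwa [H₁ᗮ.orthogonalProjectionOnto_mem_subspace_eq_self v]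
  obtain ⟨h, hc⟩ := hTΩ ⟨v, hm⟩
  have hTv : T (v : H) ∈ H₁ᗮ := apply_mem_orthogonal_of_commute hT v.2
  apply Subtype.ext
  -- With `P` the projection onto `H₁`, `T P Ω v = P T Ω v = P Ω T v`. Both `v` and `T v` lie in
  -- `H₁ᗮ`, so the outer terms are `T Γ v` and `Γ T v`.
  have e := DFunLike.congr_fun hT (blockOperator H₁ Ω₁ Ω₂ Γ ⟨v, hm⟩)
  simp only [ContinuousLinearMap.comp_apply] at e
  rw [hc, projection_blockOperator _ _ _ _ v.2, projection_blockOperator _ _ _ _ hTv] at e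
  have hv' : compression H₁ᗮ T v = ⟨T v, hTv⟩ :=
    Subtype.ext (coe_compression (fun _ => apply_mem_orthogonal_of_commute hT) v)
  simp only [ContinuousLinearMap.comp_apply]
  rw [coe_compression fun _ => apply_mem_of_commute hT, hv']
  exact e

end Block

variable [CompleteSpace H] [CompleteSpace H₁] {Γ : H₁ᗮ →L[ℂ] H₁}

theorem Model.U₂_eq (M : Model Γ H₀) (u : H₀) : M.U₂ u = polarIsometry Γ (M.U₁ u) := by
  rw [← M.symm_trans]
  simp

theorem Model.range_V₁ (M : Model Γ H₀) : M.V₁.range = H₁Γ Γ := by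
  ext x
  constructor
  · rintro ⟨u, rfl⟩
    exact ⟨M.U₁ u, (M.U₁ u).2, rfl⟩
  · rintro ⟨y, hy, rfl⟩
    refine ⟨M.U₁.symm ⟨y, hy⟩, ?_⟩
    change ((M.U₁ (M.U₁.symm ⟨y, hy⟩) : H₁) : H) = y
    rw [M.U₁.apply_symm_apply]

theorem Model.range_V₂ (M : Model Γ H₀) : M.V₂.range = H₂Γ Γ := by
  ext x
  constructor
  · rintro ⟨u, rfl⟩
    exact ⟨M.U₂ u, (M.U₂ u).2, rfl⟩
  · rintro ⟨y, hy, rfl⟩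
    refine ⟨M.U₂.symm ⟨y, hy⟩, ?_⟩
    change ((M.U₂ (M.U₂.symm ⟨y, hy⟩) : H₁ᗮ) : H) = y
    rw [M.U₂.apply_symm_apply]

/-- `U₁` as an isometry from `H₀` into `H`. -/
def Model.isometry₁ (M : Model Γ H₀) : H₀ →ₗᵢ[ℂ] H :=
  H₁.subtypeₗᵢ.comp ((clRan Γ).subtypeₗᵢ.comp M.U₁.toLinearIsometry)

/-- The operator on the model space induced through `U₁` by a bounded operator on `H`. -/
def Model.induced [CompleteSpace H₀] (M : Model Γ H₀) (T : H →L[ℂ] H) : H₀ →L[ℂ] H₀ :=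
  M.V₁.adjoint ∘L T ∘L M.V₁

variable {T : H →L[ℂ] H}

theorem Model.U₁_induced [CompleteSpace H₀] (M : Model Γ H₀) (hT₁ : ∀ x ∈ H₁, T x ∈ H₁)
    (h : compression H₁ T ∘L Γ = Γ ∘L compression H₁ᗮ T) (u : H₀) :
    M.U₁ (M.induced T u) = ⟨compression H₁ T (M.U₁ u), apply_mem_clRan h (M.U₁ u).2⟩ := by
  -- Since `T V₁ u = V₁ w`, the identity `V₁† V₁ = 1` gives `V₁† T V₁ u = w`.
  obtain ⟨w, hw⟩ := M.U₁.surjective ⟨compression H₁ T (M.U₁ u), apply_mem_clRan h (M.U₁ u).2⟩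
  have hw' : T (M.V₁ u) = M.isometry₁ w :=
    (coe_compression hT₁ _).symm.trans (congrArg (fun z : clRan Γ => ((z : H₁) : H)) hw.symm)
  rw [← hw]
  congr 1
  change M.isometry₁.toContinuousLinearMap.adjoint (T (M.V₁ u)) = w
  rw [hw']
  exact DFunLike.congr_fun
    ((ContinuousLinearMap.norm_map_iff_adjoint_comp_self _).1 M.isometry₁.norm_map) w

theorem Model.V₁_induced [CompleteSpace H₀] (M : Model Γ H₀) (hT₁ : ∀ x ∈ H₁, T x ∈ H₁)
    (h : compression H₁ T ∘L Γ = Γ ∘L compression H₁ᗮ T) :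
    M.V₁ ∘L M.induced T = T ∘L M.V₁ := by
  refine ContinuousLinearMap.ext fun u => ?_
  change ((M.U₁ (M.induced T u) : H₁) : H) = T (M.U₁ u : H₁)
  rw [M.U₁_induced hT₁ h, coe_compression hT₁]

/-- Although the induced operator is built from `U₁`, `U₂ = U U₁` and `U T₁ = T₂ U` make it
compatible with `U₂` as well. -/
theorem Model.U₂_induced [CompleteSpace H₀] (M : Model Γ H₀) (hT₁ : ∀ x ∈ H₁, T x ∈ H₁)
    (h : compression H₁ T ∘L Γ = Γ ∘L compression H₁ᗮ T)
    (h' : compression H₁ᗮ T ∘L Γ.adjoint = Γ.adjoint ∘L compression H₁ T) (u : H₀) :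
    (M.U₂ (M.induced T u) : H₁ᗮ) = compression H₁ᗮ T (M.U₂ u) := by
  rw [M.U₂_eq, M.U₂_eq, M.U₁_induced hT₁ h, polarIsometry_comm h h']

theorem Model.V₂_induced [CompleteSpace H₀] (M : Model Γ H₀) (hT₁ : ∀ x ∈ H₁, T x ∈ H₁)
    (hT₂ : ∀ x ∈ H₁ᗮ, T x ∈ H₁ᗮ)
    (h : compression H₁ T ∘L Γ = Γ ∘L compression H₁ᗮ T)
    (h' : compression H₁ᗮ T ∘L Γ.adjoint = Γ.adjoint ∘L compression H₁ T) :
    M.V₂ ∘L M.induced T = T ∘L M.V₂ := by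
  refine ContinuousLinearMap.ext fun u => ?_
  change ((M.U₂ (M.induced T u) : H₁ᗮ) : H) = T (M.U₂ u : H₁ᗮ)
  rw [M.U₂_induced hT₁ h h', coe_compression hT₂]

theorem Model.induced_comp_Γ₀ [CompleteSpace H₀] (M : Model Γ H₀) (hT₁ : ∀ x ∈ H₁, T x ∈ H₁)
    (h : compression H₁ T ∘L Γ = Γ ∘L compression H₁ᗮ T)
    (h' : compression H₁ᗮ T ∘L Γ.adjoint = Γ.adjoint ∘L compression H₁ T) :
    M.induced T ∘L M.Γ₀ = M.Γ₀ ∘L M.induced T := by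
  refine ContinuousLinearMap.ext fun u => ?_
  -- Since `U₂ Γ₀ = Γ† U₁`, applying `U₂` reduces the claim to `T₂ Γ† = Γ† T₁` on the vector `U₁ u`.
  apply M.U₂.injective
  apply Subtype.ext
  simp only [ContinuousLinearMap.comp_apply]
  rw [M.U₂_induced hT₁ h h', M.U₂_Γ₀, M.U₂_Γ₀, M.U₁_induced hT₁ h]
  exact DFunLike.congr_fun h' (M.U₁ u : H₁)

end System

end CoupledSystem

end

theorem mainTheorem7
    {H : Type*} [NormedAddCommGroup H] [InnerProductSpace ℂ H] [CompleteSpace H]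
    (H₁ : Submodule ℂ H) [CompleteSpace H₁]
    (Ω₁ : H₁ →ₗ.[ℂ] H₁) (Ω₂ : H₁ᗮ →ₗ.[ℂ] H₁ᗮ) (Γ : H₁ᗮ →L[ℂ] H₁)
    (Ω : H →ₗ.[ℂ] H) (hΩ : Ω = CoupledSystem.blockOperator H₁ Ω₁ Ω₂ Γ)
    (hΩ_sa : IsSelfAdjoint Ω)
    {H₀ : Type*} [NormedAddCommGroup H₀] [InnerProductSpace ℂ H₀] [CompleteSpace H₀]
    (M : CoupledSystem.Model Γ H₀)
    {X : Type*} [MeasurableSpace X] (π : Set X → H →L[ℂ] H)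
    (hπ : CoupledSystem.IsResolutionOfIdentity π)
    (hπΩ : CoupledSystem.CommutesWithUnbounded π Ω)
    (hπP : CoupledSystem.CommutesWith π H₁.starProjection) :
    ∃ E : Set X → H₀ →L[ℂ] H₀,
      CoupledSystem.IsResolutionOfIdentity E ∧
      CoupledSystem.CommutesWith E M.Γ₀ ∧
      (∀ A, MeasurableSet A →
        M.V₁ ∘L E A = π A ∘L M.V₁ ∧ M.V₂ ∘L E A = π A ∘L M.V₂) ∧
      (∀ A, MeasurableSet A →
        (M.V₁ ∘L E A).range = (π A).range ⊓ CoupledSystem.H₁Γ Γ ∧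
        (M.V₂ ∘L E A).range = (π A).range ⊓ CoupledSystem.H₂Γ Γ) := by
  subst hΩ
  have hT₁ : ∀ A, MeasurableSet A → ∀ x ∈ H₁, π A x ∈ H₁ := fun A hA _ =>
    CoupledSystem.apply_mem_of_commute (hπP A hA)
  have hT₂ : ∀ A, MeasurableSet A → ∀ x ∈ H₁ᗮ, π A x ∈ H₁ᗮ := fun A hA _ =>
    CoupledSystem.apply_mem_orthogonal_of_commute (hπP A hA)
  have h : ∀ A, MeasurableSet A → CoupledSystem.compression H₁ (π A) ∘L Γ
      = Γ ∘L CoupledSystem.compression H₁ᗮ (π A) := fun A hA =>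
    CoupledSystem.compression_comp_coupling hΩ_sa.dense_domain (hπP A hA) (hπΩ A hA)
  have h' : ∀ A, MeasurableSet A → CoupledSystem.compression H₁ᗮ (π A) ∘L Γ.adjoint
      = Γ.adjoint ∘L CoupledSystem.compression H₁ (π A) := fun A hA => by
    have hs := (hπ.isStarProjection A hA).isSelfAdjoint
    -- Both compressions of the projection `π A` are self-adjoint, so the adjoint of `T₁ Γ = Γ T₂`
    -- is the relation for `Γ†`.
    have := congrArg ContinuousLinearMap.adjoint (h A hA)
    rw [ContinuousLinearMap.adjoint_comp, ContinuousLinearMap.adjoint_comp,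
      CoupledSystem.isSelfAdjoint_compression _ hs,
      CoupledSystem.isSelfAdjoint_compression _ hs] at this
    exact this.symm
  have hV₁ : ∀ A, MeasurableSet A → M.V₁ ∘L M.induced (π A) = π A ∘L M.V₁ := fun A hA =>
    M.V₁_induced (hT₁ A hA) (h A hA)
  have hV₂ : ∀ A, MeasurableSet A → M.V₂ ∘L M.induced (π A) = π A ∘L M.V₂ := fun A hA =>
    M.V₂_induced (hT₁ A hA) (hT₂ A hA) (h A hA) (h' A hA)
  refine ⟨fun A => M.induced (π A),
    hπ.pullback M.isometry₁ fun A hA => DFunLike.congr_fun (hV₁ A hA),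
    fun A hA => M.induced_comp_Γ₀ (hT₁ A hA) (h A hA) (h' A hA),
    fun A hA => ⟨hV₁ A hA, hV₂ A hA⟩, fun A hA => ?_⟩
  have hi := (hπ.isStarProjection A hA).isIdempotentElem
  rw [← M.range_V₁, ← M.range_V₂]
  exact ⟨CoupledSystem.range_comp_eq_inf hi (hV₁ A hA),
    CoupledSystem.range_comp_eq_inf hi (hV₂ A hA)⟩
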